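/- Let $d\ge 0$ and let $P\subset\mathbb R^d$ be a $d$-dimensional lattice polytope, i.e. the convex hull of finitely many points of $\mathbb Z^d$ whose affine hull is $\mathbb R^d$. Suppose that $P$ is integrally closed: for every $c\in\mathbb N$ and every $z\in cP\cap\mathbb Z^d$ there are $x_1,\dots,x_c\in P\cap\mathbb Z^d$ with $x_1+\dots+x_c=z$. Put $L_P(m):=|mP\cap\mathbb Z^d|$ for integers $m\ge 0$ (so $L_P(0)=1$). Then the sequence $(L_P(m))_{m\ge 0}$ is a differentiable $O$-sequence. Here a sequence $(k_0,k_1,\dots)$ of integers is called an $O$-sequence if there are $n\ge 0$ and a nonempty set $M$ of monomials in variables $y_1,\dots,y_n$, closed under taking divisors, such that $k_j=|\{u\in M:\deg u=j\}|$ for all $j\ge 0$. An $O$-sequence $(b_i)_{i\ge 0}$ is called differentiable if the sequence $(c_i)_{i\ge 0}$ with $c_0=b_0$ and $c_i=b_i-b_{i-1}$ for $i\ge 1$ is again an $O$-sequence. -/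

import Mathlib

open scoped Pointwise

/-- The inclusion `ℤ^d ⊆ ℝ^d`. -/
def latticePt {d : ℕ} (z : Fin d → ℤ) : Fin d → ℝ := fun i => (z i : ℝ)

/-- A lattice polytope in `ℝ^d`: the convex hull of finitely many points of `ℤ^d`. -/
def IsLatticePolytope {d : ℕ} (P : Set (Fin d → ℝ)) : Prop :=
  ∃ S : Finset (Fin d → ℤ), P = convexHull ℝ (latticePt '' (S : Set (Fin d → ℤ)))

/-- `P ⊆ ℝ^d` has maximal dimension `d`: its affine hull is all of `ℝ^d`. For `d = 0` this says
that `P` is the one-point space, not the empty set. -/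
def IsFullDimensional {d : ℕ} (P : Set (Fin d → ℝ)) : Prop :=
  affineSpan ℝ P = ⊤

/-- `P` is integrally closed: for every `c`, each lattice point of the dilate `cP` is a sum of
`c` lattice points of `P`. -/
def IsIntegrallyClosedPolytope {d : ℕ} (P : Set (Fin d → ℝ)) : Prop :=
  ∀ (c : ℕ) (z : Fin d → ℤ), latticePt z ∈ (c : ℝ) • P →
    ∃ x : Fin c → (Fin d → ℤ), (∀ i, latticePt (x i) ∈ P) ∧ ∑ i, x i = z

/-- `L_P(m) = |mP ∩ ℤ^d|`. -/
noncomputable def latticePointCount {d : ℕ} (P : Set (Fin d → ℝ)) (m : ℕ) : ℕ :=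
  Set.ncard {z : Fin d → ℤ | latticePt z ∈ (m : ℝ) • P}

/-- An infinite sequence of integers is an `O`-sequence if it counts, degree by degree, the
monomials of a nonempty order ideal of monomials in finitely many variables `y_1, …, y_n`.
A monomial is given by its exponent vector, so that divisibility is the pointwise order. -/
def IsOSequence (k : ℕ → ℤ) : Prop :=
  ∃ (n : ℕ) (M : LowerSet (Fin n →₀ ℕ)), (M : Set (Fin n →₀ ℕ)).Nonempty ∧
    ∀ j : ℕ, k j = (Set.ncard {u : Fin n →₀ ℕ | u ∈ M ∧ u.degree = j} : ℤ)

/-- The difference sequence `c_i = b_i - b_{i-1}`, with `b_{-1} = 0`. -/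
def differenceSeq (b : ℕ → ℤ) : ℕ → ℤ
  | 0 => b 0
  | i + 1 => b (i + 1) - b i

/-- A differentiable `O`-sequence: an `O`-sequence whose difference sequence is again one. -/
def IsDifferentiableOSequence (b : ℕ → ℤ) : Prop :=
  IsOSequence b ∧ IsOSequence (differenceSeq b)

/-! The lattice points of all `mP` form a monomial basis of a graded algebra, which integral
closedness makes generated in degree 1. Its standard monomials for a lexicographic order are an
order ideal counted by `latticePointCount`. Multiplication by a lattice point `v` of `P` is
injective, so the differences count a basis of the quotient by `v`.
`isOSequence_ncard_of_generators` handles both families. -/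

/-- If every member of the graded family `T` is the value of a monomial of its degree in the
generators `a`, and membership in `T` passes to divisors of monomials, then the sizes of the
`T m` form an `O`-sequence: the lexicographically least monomials representing the members of `T`
are an order ideal. -/
theorem isOSequence_ncard_of_generators {G : Type*} [AddCommMonoid G] {n : ℕ} (a : Fin n → G)
    (T : ℕ → Set G)
    (hT : ∀ u v : Fin n →₀ ℕ, Finsupp.linearCombination ℕ a (u + v) ∈ T (u + v).degree →
      Finsupp.linearCombination ℕ a u ∈ T u.degree)
    (hgen : ∀ m, ∀ z ∈ T m, ∃ u : Fin n →₀ ℕ, u.degree = m ∧ Finsupp.linearCombination ℕ a u = z)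
    (h0 : 0 ∈ T 0) :
    IsOSequence (fun m => ((T m).ncard : ℤ)) := by
  let o : MonomialOrder (Fin n) := MonomialOrder.lex
  let M : LowerSet (Fin n →₀ ℕ) :=
    { carrier := {u | Finsupp.linearCombination ℕ a u ∈ T u.degree ∧
        ∀ w : Fin n →₀ ℕ, w.degree = u.degree →
          Finsupp.linearCombination ℕ a w = Finsupp.linearCombination ℕ a u →
            o.toSyn u ≤ o.toSyn w}
      lower' := by
        rintro v u huv ⟨hv, hmin⟩
        obtain ⟨t, rfl⟩ := exists_add_of_le huv
        refine ⟨hT u t hv, fun w hw hwu => ?_⟩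
        -- A competitor `w` of `u` yields the competitor `w + t` of `u + t`; the order is
        -- translation invariant, so `t` cancels.
        have h := hmin (w + t) (by simp only [map_add, hw]) (by simp only [map_add, hwu])
        simpa only [map_add, add_le_add_iff_right] using h }
  have key : ∀ m, ∀ z ∈ T m, ∃ u ∈ M, u.degree = m ∧ Finsupp.linearCombination ℕ a u = z := by
    intro m z hz
    obtain ⟨u, ⟨hum, huz⟩, hmin⟩ := (InvImage.wf o.toSyn wellFounded_lt).has_min
      {u : Fin n →₀ ℕ | u.degree = m ∧ Finsupp.linearCombination ℕ a u = z} (hgen m z hz)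
    refine ⟨u, ⟨by rwa [hum, huz], fun w hw hwu => ?_⟩, hum, huz⟩
    exact not_lt.mp (hmin w ⟨hw.trans hum, hwu.trans huz⟩)
  refine ⟨n, M, ?_, fun j => ?_⟩
  · obtain ⟨u, hu, -⟩ := key 0 0 h0
    exact ⟨u, hu⟩
  · have hbij : Set.BijOn (Finsupp.linearCombination ℕ a)
        {u : Fin n →₀ ℕ | u ∈ M ∧ u.degree = j} (T j) := by
      refine ⟨?_, ?_, ?_⟩
      · rintro u ⟨hu, rfl⟩
        exact hu.1
      · rintro u ⟨hu, rfl⟩ v ⟨hv, hvu⟩ huv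
        exact o.toSyn.injective (le_antisymm (hu.2 v hvu huv.symm) (hv.2 u hvu.symm huv))
      · intro z hz
        obtain ⟨u, hu, hum, huz⟩ := key j z hz
        exact ⟨u, ⟨hu, hum⟩, huz⟩
    beta_reduce
    rw [← hbij.image_eq, hbij.injOn.ncard_image]

theorem latticePt_add {d : ℕ} (y z : Fin d → ℤ) :
    latticePt (y + z) = latticePt y + latticePt z := by
  ext i; simp [latticePt]

theorem latticePt_nsmul {d : ℕ} (k : ℕ) (z : Fin d → ℤ) :
    latticePt (k • z) = (k : ℝ) • latticePt z := by
  ext i; simp [latticePt]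

/-- A bounded set contains only finitely many lattice points. -/
theorem finite_latticePt_preimage {d : ℕ} {B : Set (Fin d → ℝ)} (hB : Bornology.IsBounded B) :
    {z : Fin d → ℤ | latticePt z ∈ B}.Finite := by
  obtain ⟨R, hR⟩ := hB.exists_norm_le
  refine (Set.finite_Icc (fun _ => -⌈R⌉ : Fin d → ℤ) (fun _ => ⌈R⌉)).subset fun z hz => ?_
  have h : ∀ i, |(z i : ℝ)| ≤ ⌈R⌉ := fun i =>
    (norm_le_pi_norm (latticePt z) i).trans ((hR _ hz).trans (Int.le_ceil R))
  refine ⟨fun i => ?_, fun i => ?_⟩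
  · exact_mod_cast (abs_le.mp (h i)).1
  · exact_mod_cast (abs_le.mp (h i)).2

theorem latticePt_add_mem_smul {d : ℕ} {P : Set (Fin d → ℝ)} (hP : Convex ℝ P) {m k : ℕ}
    {y z : Fin d → ℤ} (hy : latticePt y ∈ (m : ℝ) • P) (hz : latticePt z ∈ (k : ℝ) • P) :
    latticePt (y + z) ∈ ((m + k : ℕ) : ℝ) • P := by
  rw [Nat.cast_add, hP.add_smul m.cast_nonneg k.cast_nonneg, latticePt_add]
  exact Set.add_mem_add hy hz

theorem latticePt_zero_mem_smul {d : ℕ} {P : Set (Fin d → ℝ)} (hP : P.Nonempty) :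
    latticePt (0 : Fin d → ℤ) ∈ ((0 : ℕ) : ℝ) • P := by
  rw [Nat.cast_zero, Set.zero_smul_set hP]
  ext i; simp [latticePt]

theorem latticePt_linearCombination_mem_smul {d n : ℕ} {P : Set (Fin d → ℝ)} (hP : Convex ℝ P)
    (hne : P.Nonempty) {a : Fin n → Fin d → ℤ} (ha : ∀ i, latticePt (a i) ∈ P)
    (u : Fin n →₀ ℕ) :
    latticePt (Finsupp.linearCombination ℕ a u) ∈ (u.degree : ℝ) • P := by
  induction u using Finsupp.induction_linear with
  | zero => simpa only [map_zero] using latticePt_zero_mem_smul hne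
  | add u v hu hv => simpa only [map_add] using latticePt_add_mem_smul hP hu hv
  | single i k =>
    rw [Finsupp.linearCombination_single, Finsupp.degree_single, latticePt_nsmul]
    exact Set.smul_mem_smul_set (ha i)

theorem IsIntegrallyClosedPolytope.exists_linearCombination_eq {d n : ℕ} {P : Set (Fin d → ℝ)}
    (hcl : IsIntegrallyClosedPolytope P) {a : Fin n → Fin d → ℤ}
    (ha : Set.range a = {z | latticePt z ∈ P}) (m : ℕ) (z : Fin d → ℤ)
    (hz : latticePt z ∈ (m : ℝ) • P) :
    ∃ u : Fin n →₀ ℕ, u.degree = m ∧ Finsupp.linearCombination ℕ a u = z := by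
  obtain ⟨x, hx, rfl⟩ := hcl m z hz
  have hx' : ∀ i, ∃ j, a j = x i := fun i => ha.ge (hx i)
  choose g hg using hx'
  refine ⟨∑ i, Finsupp.single (g i) 1, ?_, ?_⟩
  · simp [map_sum, Finsupp.degree_single]
  · simp [map_sum, hg]

/-- Translation by a lattice point of `P` embeds the lattice points of `mP` into those of
`(m+1)P`, so the difference sequence counts the lattice points outside the image. -/
theorem differenceSeq_latticePointCount {d : ℕ} {P : Set (Fin d → ℝ)} (hP : Convex ℝ P)
    (hb : Bornology.IsBounded P) {v : Fin d → ℤ} (hv : latticePt v ∈ P) :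
    differenceSeq (fun m => (latticePointCount P m : ℤ)) = fun m : ℕ =>
      ({z : Fin d → ℤ | latticePt z ∈ (m : ℝ) • P ∧
        ∀ (k : ℕ) (y : Fin d → ℤ), m = k + 1 → latticePt y ∈ (k : ℝ) • P → z ≠ y + v}.ncard : ℤ) := by
  funext m
  cases m with
  | zero => simp [differenceSeq, latticePointCount]
  | succ k =>
    have hsub : (· + v) '' {y : Fin d → ℤ | latticePt y ∈ (k : ℝ) • P} ⊆
        {z | latticePt z ∈ ((k + 1 : ℕ) : ℝ) • P} := by
      rintro _ ⟨y, hy, rfl⟩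
      exact latticePt_add_mem_smul hP hy (by simpa using hv)
    -- Boundedness matters here: `ncard` is 0 on infinite sets.
    have hfin := finite_latticePt_preimage (hb.smul₀ ((k + 1 : ℕ) : ℝ))
    have hcard := Set.ncard_sdiff_add_ncard_of_subset hsub hfin
    rw [Set.ncard_image_of_injective _ (add_left_injective v)] at hcard
    have hset : {z : Fin d → ℤ | latticePt z ∈ ((k + 1 : ℕ) : ℝ) • P ∧
        ∀ (l : ℕ) (y : Fin d → ℤ), k + 1 = l + 1 → latticePt y ∈ (l : ℝ) • P → z ≠ y + v} =
        {z | latticePt z ∈ ((k + 1 : ℕ) : ℝ) • P} \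
          (· + v) '' {y : Fin d → ℤ | latticePt y ∈ (k : ℝ) • P} := by
      ext z
      refine and_congr_right fun _ => ⟨?_, ?_⟩
      · rintro h ⟨y, hy, rfl⟩
        exact h k y rfl hy rfl
      · rintro h l y hl hy rfl
        obtain rfl : k = l := by omega
        exact h ⟨y, hy, rfl⟩
    simp only [differenceSeq, latticePointCount]
    rw [hset, ← hcard]
    push_cast
    ring

theorem mainTheorem8 (d : ℕ) (P : Set (Fin d → ℝ)) (hP : IsLatticePolytope P)
    (hdim : IsFullDimensional P) (hcl : IsIntegrallyClosedPolytope P) :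
    IsDifferentiableOSequence (fun m => (latticePointCount P m : ℤ)) := by
  have hne : P.Nonempty := by
    -- Full dimension serves only to exclude the empty polytope.
    rw [← affineSpan_nonempty ℝ, hdim]
    exact ⟨0, trivial⟩
  obtain ⟨S, hS⟩ := hP
  have hconv : Convex ℝ P := hS ▸ convex_convexHull ℝ _
  have hb : Bornology.IsBounded P := by
    rw [hS, isBounded_convexHull]
    exact (S.finite_toSet.image _).isBounded
  obtain ⟨v, hv⟩ : ∃ v : Fin d → ℤ, latticePt v ∈ P := by
    rw [hS, convexHull_nonempty_iff] at hne
    obtain ⟨_, v, hv, rfl⟩ := hne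
    exact ⟨v, hS ▸ subset_convexHull ℝ _ ⟨v, hv, rfl⟩⟩
  obtain ⟨n, a, -, ha⟩ := (finite_latticePt_preimage hb).fin_param
  have hmem := latticePt_linearCombination_mem_smul hconv hne (fun i => ha.le ⟨i, rfl⟩)
  have hgen := hcl.exists_linearCombination_eq ha
  constructor
  · exact isOSequence_ncard_of_generators a _ (fun u _ _ => hmem u) hgen
      (latticePt_zero_mem_smul hne)
  · rw [differenceSeq_latticePointCount hconv hb hv]
    refine isOSequence_ncard_of_generators a _ (fun u w h => ⟨hmem u, ?_⟩)
      (fun m z hz => hgen m z hz.1) ⟨latticePt_zero_mem_smul hne, fun k y hk => by omega⟩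
    -- The translates by `v` form an ideal: if `u` has value `y + v`, then `u + w` has value `(y +
    -- value of w) + v`, contradicting `h`.
    intro k y hk hy huy
    refine h.2 (k + w.degree) (y + Finsupp.linearCombination ℕ a w) ?_
      (latticePt_add_mem_smul hconv hy (hmem w)) ?_
    · rw [map_add, hk]; ring
    · rw [map_add, huy]; abel
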